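/- **Definitions.** A *triangulation* $T$ is a nonempty finite family of tetrahedra together with a complete system of pairings of their faces by simplicial isomorphisms (each face is glued to exactly one other face; two faces of the same tetrahedron may be glued to each other) such that the resulting gluing is connected; the gluing is not required to be a manifold. The *butterfly* $B$ in a tetrahedron $\Delta$ is the cone, with vertex the centre of $\Delta$, over the union of the four $\mathsf Y$-shaped graphs dual to the triangular faces of $\Delta$; equivalently, it is the set of points of $\Delta$ whose largest barycentric coordinate is attained at least twice. The *special polyhedron* dual to $T$ is the quotient space $P$ obtained from one butterfly in each tetrahedron of $T$ by gluing them along their $\mathsf Y$-shaped faces via the maps induced by the face-pairings. Its *vertices* are the centres of the butterflies, and $c(P)$ denotes their number, which is the number of tetrahedra of $T$. A *combinatorial automorphism* of $P$ is a self-homeomorphism of $P$ that carries each butterfly onto a butterfly by a map induced by a simplicial isomorphism of the tetrahedra, and whose inverse has the same property. (So the combinatorial automorphisms of $P$ form a group under composition, which is the group of combinatorial automorphisms of the triangulation $T$.) **Proposition.** There exists a constant $k>0$ such that for every finite group $G$ there is a special polyhedron $P_G$ whose group of combinatorial automorphisms is isomorphic to $G$ and which satisfies $c(P_G)\leqslant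 k\cdot |G|^9$. -/

import Mathlib

/-- A (loose, three-dimensional) triangulation: a nonempty finite family of tetrahedra, each with
vertices `0, 1, 2, 3`, whose faces are glued in pairs by simplicial isomorphisms so that the result
is connected.  Face `i` of a tetrahedron is the face opposite to its vertex `i`.  Multiple and
self-adjacencies are allowed, and the gluing need not be a manifold. -/
structure Triangulation where
  /-- The set of tetrahedra. -/
  Tet : Type
  finite_tet : Finite Tet
  nonempty_tet : Nonempty Tet
  /-- The tetrahedron glued to `Δ` along face `i` of `Δ`. -/
  adj : Tet → Fin 4 → Tet
  /-- The pairing of face `i` of `Δ`: vertex `j ≠ i` of `Δ` is glued to vertex `pair Δ i j` of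
  `adj Δ i`.  It is extended by sending `i` to the vertex opposite to the partner face, so that the
  partner of face `i` of `Δ` is face `pair Δ i i` of `adj Δ i`. -/
  pair : Tet → Fin 4 → Equiv.Perm (Fin 4)
  adj_adj : ∀ Δ i, adj (adj Δ i) (pair Δ i i) = Δ
  pair_pair : ∀ Δ i, pair (adj Δ i) (pair Δ i i) = (pair Δ i)⁻¹
  /-- No face is glued to itself. -/
  ne_self : ∀ Δ i, ¬ (adj Δ i = Δ ∧ pair Δ i i = i)
  connected : ∀ Δ Δ', Relation.ReflTransGen (fun a b => ∃ i, adj a i = b) Δ Δ'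

/-- The butterfly, i.e. the standard neighbourhood of a vertex in a special polyhedron: the cone
from the centre of the tetrahedron over the `Y`-shaped dual graphs of its four faces.  In
barycentric coordinates it consists of the points whose largest coordinate is attained at least
twice (the `Y` in face `i` is the part with `x i = 0`, the cone point is the barycentre). -/
def Butterfly : Type :=
  {x : Fin 4 → ℝ // x ∈ stdSimplex ℝ (Fin 4) ∧
    ∃ i j : Fin 4, i ≠ j ∧ x i = x j ∧ ∀ l, x l ≤ x i}

namespace Butterfly

instance : TopologicalSpace Butterfly :=
  inferInstanceAs (TopologicalSpace (Subtype _))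

/-- The symmetry of the butterfly induced by a permutation of the vertices of the tetrahedron:
coordinate `σ j` of the image of `x` is coordinate `j` of `x`. -/
def perm (σ : Equiv.Perm (Fin 4)) (x : Butterfly) : Butterfly :=
  ⟨fun j => x.1 (σ.symm j), by
    obtain ⟨x, ⟨h0, h1⟩, i, j, hij, he, hm⟩ := x
    refine ⟨⟨fun l => h0 _, ?_⟩, σ i, σ j, fun h => hij (σ.injective h), by simpa using he,
      fun l => by simpa using hm _⟩
    exact (Equiv.sum_comp σ.symm x).trans h1⟩

theorem perm_one (x : Butterfly) : perm 1 x = x := rfl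

theorem perm_mul (σ τ : Equiv.Perm (Fin 4)) (x : Butterfly) :
    perm (σ * τ) x = perm σ (perm τ x) := rfl

/-- The cone point, i.e. the barycentre of the tetrahedron. -/
noncomputable def center : Butterfly :=
  ⟨fun _ => 1 / 4, ⟨fun _ => by norm_num, by norm_num⟩, 0, 1, by decide, rfl, fun _ => le_rfl⟩

end Butterfly

namespace Triangulation

/-- The elementary identifications: a point `x` of the face `i` of the butterfly in `Δ` is glued to
its image under the face-pairing. -/
def Glue (T : Triangulation) (p q : Σ _ : T.Tet, Butterfly) : Prop :=
  ∃ i : Fin 4, p.2.1 i = 0 ∧ q = ⟨T.adj p.1 i, Butterfly.perm (T.pair p.1 i) p.2⟩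

/-- The special polyhedron dual to a triangulation, with the quotient topology: one butterfly in
each tetrahedron, glued along their `Y`-shaped faces by the maps induced by the face-pairings. -/
def SpecialPolyhedron (T : Triangulation) : Type :=
  Quot T.Glue

instance (T : Triangulation) : TopologicalSpace T.SpecialPolyhedron :=
  inferInstanceAs (TopologicalSpace (Quot T.Glue))

/-- The point of the special polyhedron given by the point `x` of the butterfly in `Δ`. -/
def toPolyhedron (T : Triangulation) (Δ : T.Tet) (x : Butterfly) : T.SpecialPolyhedron :=
  Quot.mk T.Glue ⟨Δ, x⟩

/-- The (true) vertices of the special polyhedron: the centres of the butterflies. -/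
def vertices (T : Triangulation) : Set T.SpecialPolyhedron :=
  Set.range fun Δ => T.toPolyhedron Δ Butterfly.center

/-- The map carries every butterfly onto a butterfly by a symmetry of the model. -/
def IsCombinatorial (T : Triangulation) (f : T.SpecialPolyhedron → T.SpecialPolyhedron) : Prop :=
  ∀ Δ, ∃ (Δ' : T.Tet) (σ : Equiv.Perm (Fin 4)),
    ∀ x, f (T.toPolyhedron Δ x) = T.toPolyhedron Δ' (Butterfly.perm σ x)

/-- The group of combinatorial automorphisms of the special polyhedron: the self-homeomorphisms
that, like their inverses, carry butterflies to butterflies by symmetries of the model. -/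
def combAut (T : Triangulation) : Subgroup (T.SpecialPolyhedron ≃ₜ T.SpecialPolyhedron) where
  carrier := {f | T.IsCombinatorial f ∧ T.IsCombinatorial f.symm}
  one_mem' := ⟨fun Δ => ⟨Δ, 1, fun _ => rfl⟩, fun Δ => ⟨Δ, 1, fun _ => rfl⟩⟩
  mul_mem' := by
    have key : ∀ f g : T.SpecialPolyhedron → T.SpecialPolyhedron,
        T.IsCombinatorial f → T.IsCombinatorial g → T.IsCombinatorial fun p => f (g p) := by
      intro f g hf hg Δ
      obtain ⟨Δ', σ, h⟩ := hg Δ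
      obtain ⟨Δ'', τ, h'⟩ := hf Δ'
      exact ⟨Δ'', τ * σ, fun x => by
        change f (g _) = _
        rw [h, h', Butterfly.perm_mul]⟩
    rintro f g ⟨hf, hf'⟩ ⟨hg, hg'⟩
    exact ⟨key f g hf hg, key g.symm f.symm hg' hf'⟩
  inv_mem' := by
    rintro f ⟨hf, hf'⟩
    exact ⟨hf', hf⟩

end Triangulation

/-! A decorated Cayley graph realises `G`. Over each group element lies a cycle of tetrahedra joined
through faces 0 and 1; faces 2 and 3 of the `i`-th one carry right multiplication by `s i`, where
`s` is onto. Left multiplication acts freely and preserves all labels.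

There are no further automorphisms. One that fixes a butterfly pointwise is trivial by connectedness
(`eq_id_of_carries`), so it suffices to know the image of one tetrahedron (`labelHom_bijective`). As
`s 0 = s 1 = 1`, tetrahedra 0 and 1 are glued to themselves, by pairings of order 4 and 3, while all
other pairings are involutions. Order 4 singles out index 0, and order 3 at index 1 excludes
reversing the cycle (`cayley_rigid`). About `|G|^2` tetrahedra suffice. -/

namespace Butterfly

/-! ### Test points that detect symmetries of the butterfly -/

theorem perm_apply (σ : Equiv.Perm (Fin 4)) (x : Butterfly) (j : Fin 4) :
    (perm σ x).1 (σ j) = x.1 j := by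
  simp [perm]

theorem perm_inv_perm (σ : Equiv.Perm (Fin 4)) (x : Butterfly) : perm σ⁻¹ (perm σ x) = x := by
  rw [← perm_mul, inv_mul_cancel, perm_one]

/-- The interior point of the butterfly whose coordinate `k` is half of each of the others. -/
noncomputable def interiorPoint (k : Fin 4) : Butterfly :=
  ⟨fun l => if l = k then 1 / 7 else 2 / 7, by
    refine ⟨⟨fun l => by dsimp only; split_ifs <;> norm_num, ?_⟩, k + 1, k + 2, ?_, ?_, ?_⟩
    · fin_cases k <;> simp [Fin.sum_univ_four] <;> norm_num
    · fin_cases k <;> decide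
    · fin_cases k <;> simp +decide
    · intro l
      have : k + 1 ≠ k := by fin_cases k <;> decide
      simp only [if_neg this]
      split_ifs <;> norm_num⟩

/-- The point of the face `i` of the butterfly whose coordinate `k` is half of each of the other
two nonzero ones. -/
noncomputable def facePoint (i k : Fin 4) (h : k ≠ i) : Butterfly :=
  ⟨fun l => if l = i then 0 else if l = k then 1 / 5 else 2 / 5, by
    have key : ∃ a b : Fin 4, a ≠ b ∧ a ≠ i ∧ a ≠ k ∧ b ≠ i ∧ b ≠ k := by
      revert i k; decide
    obtain ⟨a, b, hab, hai, hak, hbi, hbk⟩ := key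
    refine ⟨⟨fun l => by dsimp only; split_ifs <;> norm_num, ?_⟩, a, b, hab, ?_, ?_⟩
    · clear hab hai hak hbi hbk a b
      fin_cases i <;> fin_cases k <;> simp [Fin.sum_univ_four] at h ⊢ <;> norm_num
    · simp [hai, hak, hbi, hbk]
    · intro l
      simp only [hai, hak, if_false]
      split_ifs <;> norm_num⟩

theorem interiorPoint_ne_zero (k l : Fin 4) : (interiorPoint k).1 l ≠ 0 := by
  simp only [interiorPoint]
  split_ifs <;> norm_num

theorem facePoint_eq_zero_iff {i k : Fin 4} (h : k ≠ i) (l : Fin 4) :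
    (facePoint i k h).1 l = 0 ↔ l = i := by
  simp only [facePoint]
  split_ifs <;> simp_all

theorem perm_injective_of_interiorPoint {σ τ : Equiv.Perm (Fin 4)}
    (h : ∀ k, perm σ (interiorPoint k) = perm τ (interiorPoint k)) : σ = τ := by
  refine inv_injective (Equiv.ext fun j => ?_)
  by_contra hne
  have := congrFun (congrArg Subtype.val (h (σ⁻¹ j))) j
  change (interiorPoint _).1 (σ⁻¹ j) = (interiorPoint _).1 (τ⁻¹ j) at this
  simp only [interiorPoint, if_true, if_neg (Ne.symm hne)] at this
  norm_num at this

/-- One face suffices, since a permutation of four vertices is determined by its values on three. -/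
theorem perm_injective_of_facePoint {σ τ : Equiv.Perm (Fin 4)} (i : Fin 4)
    (h : ∀ k hk, perm σ (facePoint i k hk) = perm τ (facePoint i k hk)) : σ = τ := by
  have key : ∀ a b : Fin 4, (∀ k hk, (facePoint i k hk).1 a = (facePoint i k hk).1 b) →
      a ≠ i → a = b := by
    intro a b hab ha
    by_contra hne
    have := hab a ha
    simp only [facePoint, if_neg ha, if_true, if_neg (Ne.symm hne)] at this
    split_ifs at this <;> norm_num at this
  refine inv_injective (Equiv.ext fun j => ?_)
  have hj : ∀ k hk, (facePoint i k hk).1 (σ⁻¹ j) = (facePoint i k hk).1 (τ⁻¹ j) :=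
    fun k hk => congrFun (congrArg Subtype.val (h k hk)) j
  by_cases h1 : σ⁻¹ j = i
  · by_cases h2 : τ⁻¹ j = i
    · rw [h1, h2]
    · exact (key _ _ (fun k hk => (hj k hk).symm) h2).symm
  · exact key _ _ hj h1

end Butterfly

/-! ### Which points of the butterflies are identified -/

namespace Triangulation

open Butterfly

theorem Glue.symm {T : Triangulation} {p q : Σ _ : T.Tet, Butterfly} (h : T.Glue p q) :
    T.Glue q p := by
  obtain ⟨i, hi, rfl⟩ := h
  refine ⟨T.pair p.1 i i, by rw [perm_apply, hi], ?_⟩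
  dsimp only
  rw [T.adj_adj, T.pair_pair, perm_inv_perm]

/-- A point on at most one face is only identified with itself and its partner. -/
theorem eq_or_glue_of_toPolyhedron_eq (T : Triangulation) {p q : Σ _ : T.Tet, Butterfly}
    (hp : ∀ i j, p.2.1 i = 0 → p.2.1 j = 0 → i = j)
    (h : T.toPolyhedron p.1 p.2 = T.toPolyhedron q.1 q.2) : q = p ∨ T.Glue p q := by
  have step : ∀ q r, T.Glue q r → (q = p ∨ T.Glue p q) → (r = p ∨ T.Glue p r) := by
    rintro q r hqr (rfl | hpq)
    · exact Or.inr hqr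
    · left
      obtain ⟨i, hi, rfl⟩ := hpq
      obtain ⟨j, hj, rfl⟩ := hqr
      obtain ⟨j, rfl⟩ := (T.pair p.1 i).surjective j
      dsimp only at hj ⊢
      rw [perm_apply] at hj
      obtain rfl := hp i j hi hj
      rw [T.adj_adj, T.pair_pair, perm_inv_perm]
  -- The set of `p` and its partner is stable under gluing, so membership descends to the quotient.
  let S : T.SpecialPolyhedron → Prop := Quot.lift (fun q => q = p ∨ T.Glue p q)
    fun q r hqr => propext ⟨step q r hqr, step r q hqr.symm⟩
  have hS : S (T.toPolyhedron p.1 p.2) := Or.inl rfl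
  rw [h] at hS
  exact hS

theorem toPolyhedron_interior_inj (T : Triangulation) {Δ Δ' : T.Tet} {x y : Butterfly}
    (hx : ∀ i, x.1 i ≠ 0) (h : T.toPolyhedron Δ x = T.toPolyhedron Δ' y) : Δ = Δ' ∧ x = y := by
  rcases T.eq_or_glue_of_toPolyhedron_eq (p := ⟨Δ, x⟩) (q := ⟨Δ', y⟩)
    (fun i _ hi => absurd hi (hx i)) h with h | ⟨i, hi, -⟩
  · cases h
    exact ⟨rfl, rfl⟩
  · exact absurd hi (hx i)

theorem toPolyhedron_adj (T : Triangulation) (Δ : T.Tet) (i : Fin 4) {x : Butterfly}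
    (hx : x.1 i = 0) :
    T.toPolyhedron (T.adj Δ i) (perm (T.pair Δ i) x) = T.toPolyhedron Δ x :=
  (Quot.sound ⟨i, hx, rfl⟩ : T.toPolyhedron Δ x = _).symm

/-! ### Combinatorial maps and their rigidity -/

/-- The map `f` carries the butterfly in `Δ` onto the one in `Δ'` by the symmetry `σ`. -/
def Carries (T : Triangulation) (f : T.SpecialPolyhedron → T.SpecialPolyhedron) (Δ Δ' : T.Tet)
    (σ : Equiv.Perm (Fin 4)) : Prop :=
  ∀ x, f (T.toPolyhedron Δ x) = T.toPolyhedron Δ' (perm σ x)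

theorem perm_interiorPoint_ne_zero (σ : Equiv.Perm (Fin 4)) (k i : Fin 4) :
    (perm σ (interiorPoint k)).1 i ≠ 0 :=
  interiorPoint_ne_zero k _

variable {T : Triangulation} {f : T.SpecialPolyhedron → T.SpecialPolyhedron}

theorem Carries.unique {Δ Δ₁ Δ₂ : T.Tet} {σ τ : Equiv.Perm (Fin 4)} (h₁ : T.Carries f Δ Δ₁ σ)
    (h₂ : T.Carries f Δ Δ₂ τ) : Δ₁ = Δ₂ ∧ σ = τ := by
  have key := fun k => T.toPolyhedron_interior_inj (perm_interiorPoint_ne_zero σ k)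
    ((h₁ (interiorPoint k)).symm.trans (h₂ (interiorPoint k)))
  exact ⟨(key 0).1, perm_injective_of_interiorPoint fun k => (key k).2⟩

theorem Carries.injective (hf : Function.Injective f) {Δ Δ₁ Δ₂ : T.Tet}
    {σ τ : Equiv.Perm (Fin 4)} (h₁ : T.Carries f Δ₁ Δ σ) (h₂ : T.Carries f Δ₂ Δ τ) : Δ₁ = Δ₂ := by
  have h : f (T.toPolyhedron Δ₁ (interiorPoint 0)) =
      f (T.toPolyhedron Δ₂ (perm (τ⁻¹ * σ) (interiorPoint 0))) := by
    rw [h₁, h₂, ← perm_mul, mul_inv_cancel_left]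
  exact (T.toPolyhedron_interior_inj (interiorPoint_ne_zero 0) (hf h)).1

/-- Injective combinatorial maps are compatible with the face-pairings. -/
theorem Carries.adj (hf : Function.Injective f) {Δ Δ₁ Δ₂ : T.Tet} {σ τ : Equiv.Perm (Fin 4)}
    {i : Fin 4} (h₁ : T.Carries f Δ Δ₁ σ) (h₂ : T.Carries f (T.adj Δ i) Δ₂ τ) :
    Δ₂ = T.adj Δ₁ (σ i) ∧ τ * T.pair Δ i = T.pair Δ₁ (σ i) * σ := by
  have key : ∀ k (hk : k ≠ i), Δ₂ = T.adj Δ₁ (σ i) ∧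
      perm (τ * T.pair Δ i) (facePoint i k hk) =
        perm (T.pair Δ₁ (σ i) * σ) (facePoint i k hk) := by
    intro k hk
    have hz : ∀ (ρ : Equiv.Perm (Fin 4)) l, (perm ρ (facePoint i k hk)).1 l = 0 → l = ρ i := by
      intro ρ l hl
      exact Equiv.Perm.inv_eq_iff_eq.1 ((facePoint_eq_zero_iff hk (ρ⁻¹ l)).1 hl)
    have hi : (facePoint i k hk).1 i = 0 := (facePoint_eq_zero_iff hk i).2 rfl
    have heq : T.toPolyhedron Δ₁ (perm σ (facePoint i k hk)) =
        T.toPolyhedron Δ₂ (perm (τ * T.pair Δ i) (facePoint i k hk)) := by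
      rw [perm_mul, ← h₁, ← h₂, T.toPolyhedron_adj Δ i hi]
    rcases T.eq_or_glue_of_toPolyhedron_eq (p := ⟨Δ₁, perm σ (facePoint i k hk)⟩)
      (q := ⟨Δ₂, perm (τ * T.pair Δ i) (facePoint i k hk)⟩)
      (fun a b ha hb => (hz σ a ha).trans (hz σ b hb).symm) heq with h | ⟨j, hj, h⟩
    -- If the two representatives coincide, injectivity forces face `i` of `Δ` to be glued to
    -- itself.
    · exfalso
      obtain ⟨rfl, h'⟩ := Sigma.mk.inj_iff.1 h
      have hΔ := Carries.injective hf h₂ h₁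
      rw [hΔ] at h₂
      obtain rfl := (h₁.unique h₂).2
      have h := congrFun (congrArg Subtype.val (eq_of_heq h')) (σ i)
      rw [perm_apply, hi] at h
      have := hz _ _ h
      rw [Equiv.Perm.mul_apply, σ.injective.eq_iff] at this
      exact T.ne_self Δ i ⟨hΔ, this.symm⟩
    · obtain rfl := hz σ j hj
      obtain ⟨h, h'⟩ := Sigma.mk.inj_iff.1 h
      exact ⟨h, eq_of_heq h'⟩
  obtain ⟨k, hk⟩ := exists_ne i
  exact ⟨(key k hk).1, perm_injective_of_facePoint i fun k hk => (key k hk).2⟩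

/-- An automorphism that fixes one butterfly pointwise is trivial. -/
theorem eq_id_of_carries (hf : Function.Injective f) (hc : T.IsCombinatorial f) {Δ : T.Tet}
    (h : T.Carries f Δ Δ 1) : f = id := by
  have all : ∀ Δ', T.Carries f Δ' Δ' 1 := by
    intro Δ'
    induction T.connected Δ Δ' with
    | refl => exact h
    | tail _ hstep ih =>
      obtain ⟨i, rfl⟩ := hstep
      obtain ⟨Δ₂, τ, h₂⟩ := hc (T.adj _ i)
      obtain ⟨rfl, h'⟩ := Carries.adj hf ih h₂
      rw [mul_one, Equiv.Perm.one_apply, mul_eq_right] at h'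
      subst h'
      exact h₂
  funext p
  induction p using Quot.ind with
  | mk p => exact all p.1 p.2

/-! ### Label-preserving actions -/

/-- A symmetry of the triangulation that preserves the labels of the vertices of the tetrahedra
acts on the special polyhedron. -/
def labelMap (T : Triangulation) (φ : T.Tet → T.Tet)
    (hadj : ∀ Δ i, T.adj (φ Δ) i = φ (T.adj Δ i)) (hpair : ∀ Δ i, T.pair (φ Δ) i = T.pair Δ i) :
    T.SpecialPolyhedron → T.SpecialPolyhedron :=
  Quot.map (fun p => ⟨φ p.1, p.2⟩) (by
    rintro p q ⟨i, hi, rfl⟩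
    exact ⟨i, hi, by dsimp only; rw [hadj, hpair]⟩)

theorem continuous_labelMap (φ : T.Tet → T.Tet) (hadj : ∀ Δ i, T.adj (φ Δ) i = φ (T.adj Δ i))
    (hpair : ∀ Δ i, T.pair (φ Δ) i = T.pair Δ i) : Continuous (T.labelMap φ hadj hpair) :=
  continuous_quot_lift _ (continuous_quot_mk.comp
    (continuous_sigma fun Δ => continuous_sigmaMk (σ := fun _ : T.Tet => Butterfly) (i := φ Δ)))

/-- A label-preserving action of a group on a triangulation induces an action on the special
polyhedron by combinatorial automorphisms. -/
def labelHom (T : Triangulation) {H : Type} [Group H] [MulAction H T.Tet]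
    (hadj : ∀ (g : H) Δ i, T.adj (g • Δ) i = g • T.adj Δ i)
    (hpair : ∀ (g : H) Δ i, T.pair (g • Δ) i = T.pair Δ i) : H →* T.combAut where
  toFun g :=
    ⟨{  toFun := T.labelMap (g • ·) (hadj g) (hpair g)
        invFun := T.labelMap (g⁻¹ • ·) (hadj g⁻¹) (hpair g⁻¹)
        left_inv := by
          rintro ⟨Δ, x⟩
          exact congrArg (T.toPolyhedron · x) (inv_smul_smul g Δ)
        right_inv := by
          rintro ⟨Δ, x⟩
          exact congrArg (T.toPolyhedron · x) (smul_inv_smul g Δ)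
        continuous_toFun := continuous_labelMap _ _ _
        continuous_invFun := continuous_labelMap _ _ _ },
      fun Δ => ⟨g • Δ, 1, fun _ => rfl⟩, fun Δ => ⟨g⁻¹ • Δ, 1, fun _ => rfl⟩⟩
  map_one' := by
    refine Subtype.ext (Homeomorph.ext ?_)
    rintro ⟨Δ, x⟩
    exact congrArg (T.toPolyhedron · x) (one_smul H Δ)
  map_mul' g h := by
    refine Subtype.ext (Homeomorph.ext ?_)
    rintro ⟨Δ, x⟩
    exact congrArg (T.toPolyhedron · x) (mul_smul g h Δ)

/-- If a label-preserving action is free at the tetrahedron `Δ`, and every automorphism carries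
`Δ` to a translate of it, then the acting group is the whole automorphism group. -/
theorem labelHom_bijective {H : Type} [Group H] [MulAction H T.Tet]
    (hadj : ∀ (g : H) Δ i, T.adj (g • Δ) i = g • T.adj Δ i)
    (hpair : ∀ (g : H) Δ i, T.pair (g • Δ) i = T.pair Δ i) (Δ : T.Tet)
    (hfree : ∀ g : H, g • Δ = Δ → g = 1)
    (hrigid : ∀ f : T.combAut, ∃ g : H, T.Carries f.1 Δ (g • Δ) 1) :
    Function.Bijective (T.labelHom hadj hpair) := by
  have hcarry : ∀ g Δ', T.Carries (T.labelHom hadj hpair g).1 Δ' (g • Δ') 1 := fun g Δ' x => rfl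
  refine ⟨(injective_iff_map_eq_one _).2 fun g hg => hfree g ?_, fun f => ?_⟩
  · have h1 : T.Carries (T.labelHom hadj hpair g).1 Δ Δ 1 := by
      rw [hg]
      exact fun x => rfl
    exact ((hcarry g Δ).unique h1).1
  · obtain ⟨g, hg⟩ := hrigid f
    refine ⟨g, ?_⟩
    have h1 : T.Carries ((T.labelHom hadj hpair g)⁻¹ * f).1 Δ Δ 1 := by
      intro x
      rw [← map_inv]
      change (T.labelHom hadj hpair g⁻¹).1 (f.1 _) = _
      rw [hg x, hcarry g⁻¹ (g • Δ) _, inv_smul_smul]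
      rfl
    have h2 := eq_id_of_carries (Homeomorph.injective _)
      ((T.labelHom hadj hpair g)⁻¹ * f).2.1 h1
    refine inv_mul_eq_one.1 (Subtype.ext (Homeomorph.ext fun p => ?_))
    exact congrFun h2 p

/-! ### The Cayley triangulation -/

/-- The face-pairing within the `i`-th tetrahedron of the base of `cayley`: its order is `4` for
`i = 0`, `3` for `i = 1` and `2` otherwise. -/
def loopPerm {N : ℕ} (i : Fin (N + 3)) : Equiv.Perm (Fin 4) :=
  if i = 0 then finRotate 4
  else if i = 1 then Equiv.swap 0 3 * Equiv.swap 0 2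
  else Equiv.swap 2 3

theorem loopPerm_two {N : ℕ} (i : Fin (N + 3)) : loopPerm i 2 = 3 := by
  unfold loopPerm
  split_ifs <;> decide

theorem loopPerm_inv_three {N : ℕ} (i : Fin (N + 3)) : (loopPerm i)⁻¹ 3 = 2 := by
  rw [Equiv.Perm.inv_eq_iff_eq, loopPerm_two]

/-- The adjacency of the Cayley triangulation. -/
def cayleyAdj {H : Type} [Group H] {N : ℕ} (s : Fin (N + 3) → H) (p : H × Fin (N + 3)) :
    Fin 4 → H × Fin (N + 3) :=
  ![(p.1, p.2 + 1), (p.1, p.2 - 1), (p.1 * s p.2, p.2), (p.1 * (s p.2)⁻¹, p.2)]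

/-- The face-pairings of the Cayley triangulation. -/
def cayleyPair {N : ℕ} (i : Fin (N + 3)) : Fin 4 → Equiv.Perm (Fin 4) :=
  ![Equiv.swap 0 1, Equiv.swap 0 1, loopPerm i, (loopPerm i)⁻¹]

open Fin.NatCast Fin.CommRing in
theorem cayley_connected {H : Type} [Group H] {N : ℕ} {s : Fin (N + 3) → H}
    (hs : Function.Surjective s) (p q : H × Fin (N + 3)) :
    Relation.ReflTransGen (fun a b => ∃ i, cayleyAdj s a i = b) p q := by
  have up : ∀ (g : H) (i : Fin (N + 3)) (n : ℕ),
      Relation.ReflTransGen (fun a b => ∃ i, cayleyAdj s a i = b) (g, i)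
        (g, i + (n : Fin (N + 3))) := by
    intro g i n
    induction n with
    | zero => simpa using Relation.ReflTransGen.refl
    | succ n ih => exact ih.tail ⟨0, by simp [cayleyAdj, add_assoc]⟩
  have fiber : ∀ (g : H) (i j : Fin (N + 3)),
      Relation.ReflTransGen (fun a b => ∃ i, cayleyAdj s a i = b) (g, i) (g, j) := by
    intro g i j
    have := up g i (j - i).val
    rwa [Fin.cast_val_eq_self, add_sub_cancel] at this
  obtain ⟨g, i⟩ := p
  obtain ⟨h, j⟩ := q
  obtain ⟨k, hk⟩ := hs (g⁻¹ * h)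
  refine ((fiber g i k).tail ⟨2, ?_⟩).trans (fiber h k j)
  simp [cayleyAdj, hk]

/-- For every element `g` of the group, a closed chain of tetrahedra, the `i`-th of which is glued
to the `i`-th tetrahedron in the chain of `g * s i`. -/
def cayley (H : Type) [Group H] [Finite H] {N : ℕ} (s : Fin (N + 3) → H)
    (hs : Function.Surjective s) : Triangulation where
  Tet := H × Fin (N + 3)
  finite_tet := inferInstance
  nonempty_tet := inferInstance
  adj := cayleyAdj s
  pair p := cayleyPair p.2
  adj_adj := by
    rintro ⟨g, j⟩ i
    fin_cases i <;> simp [cayleyAdj, cayleyPair, loopPerm_two, loopPerm_inv_three]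
  pair_pair := by
    rintro ⟨g, j⟩ i
    fin_cases i <;> simp [cayleyAdj, cayleyPair, loopPerm_two, loopPerm_inv_three]
  ne_self := by
    rintro ⟨g, j⟩ i ⟨-, h⟩
    fin_cases i <;> simp [cayleyPair, loopPerm_two, loopPerm_inv_three] at h
  connected := cayley_connected hs

/-- Conjugation preserves order, and only index 0 has pairings of order 4. There `σ` fixes 2 and
commutes with the rotation, or sends 2 to 3 and inverts it; the latter is a reflection swapping 0
and 1. -/
theorem cayleyPair_conj_finRotate {N : ℕ} {j : Fin (N + 3)} {σ : Equiv.Perm (Fin 4)}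
    (h : σ * finRotate 4 = cayleyPair j (σ 2) * σ) :
    j = 0 ∧ (σ = 1 ∨ σ 0 = 1) := by
  unfold cayleyPair loopPerm at h
  split_ifs at h with h0 h1
  · refine ⟨h0, ?_⟩
    clear h0
    revert σ
    decide
  · exfalso
    clear h0 h1
    revert σ
    decide
  · exfalso
    clear h0 h1
    revert σ
    decide

/-- A 3-cycle is not conjugate to an involution. -/
theorem cayleyPair_not_conj {N : ℕ} {j : Fin (N + 3)} {σ : Equiv.Perm (Fin 4)} (h0 : j ≠ 0)
    (h1 : j ≠ 1) : σ * (Equiv.swap 0 3 * Equiv.swap 0 2) ≠ cayleyPair j (σ 2) * σ := by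
  unfold cayleyPair loopPerm
  rw [if_neg h0, if_neg h1]
  clear h0 h1
  revert σ
  decide

theorem cayley_rigid (H : Type) [Group H] [Finite H] {N : ℕ} (s : Fin (N + 3) → H)
    (hs : Function.Surjective s) (h0 : s 0 = 1) (h1 : s 1 = 1) (f : (cayley H s hs).combAut) :
    ∃ g : H, (cayley H s hs).Carries f.1 ((1, 0) : H × Fin (N + 3))
      ((g, 0) : H × Fin (N + 3)) 1 := by
  have hinj : Function.Injective f.1 := Homeomorph.injective _
  obtain ⟨⟨g, j⟩, σ, hσ⟩ := f.2.1 ((1, 0) : H × Fin (N + 3))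
  have loop₀ : (cayley H s hs).adj ((1, 0) : H × Fin (N + 3)) 2 = ((1, 0) : H × Fin (N + 3)) := by
    simp [cayley, cayleyAdj, h0]
  have hconj := (Carries.adj (i := 2) hinj hσ (loop₀.symm ▸ hσ)).2
  obtain ⟨rfl, rfl | hσ0⟩ := cayleyPair_conj_finRotate hconj
  · exact ⟨g, hσ⟩
  exfalso
  -- With the cycle reversed, the tetrahedron of index 1 would go to one of index -1.
  have next : (cayley H s hs).adj ((1, 0) : H × Fin (N + 3)) 0 = ((1, 1) : H × Fin (N + 3)) := by
    simp [cayley, cayleyAdj]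
  obtain ⟨⟨g', j'⟩, τ, hτ⟩ := f.2.1 ((1, 1) : H × Fin (N + 3))
  have hj := (Carries.adj (i := 0) hinj hσ (next.symm ▸ hτ)).1
  rw [hσ0] at hj
  have hj' : j' = 0 - 1 := congrArg Prod.snd hj
  have loop₁ : (cayley H s hs).adj ((1, 1) : H × Fin (N + 3)) 2 = ((1, 1) : H × Fin (N + 3)) := by
    simp [cayley, cayleyAdj, h1]
  have hconj' := (Carries.adj (i := 2) hinj hτ (loop₁.symm ▸ hτ)).2
  -- The cycle has length at least 3, so -1 is neither 0 nor 1.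
  have hlast : (0 - 1 : Fin (N + 3)) = Fin.last (N + 2) := by
    rw [zero_sub]
    exact neg_eq_of_add_eq_zero_left (Fin.last_add_one _)
  refine cayleyPair_not_conj (N := N) (j := j') (σ := τ) ?_ ?_ hconj'
  · rw [hj', hlast]
    simp [Fin.ext_iff]
  · rw [hj', hlast]
    simp [Fin.ext_iff]

/-! ### Conclusion -/

theorem exists_combAut_equiv (H : Type) [Group H] [Finite H] :
    ∃ T : Triangulation, Nonempty (T.combAut ≃* H) ∧
      T.vertices.ncard ≤ Nat.card H * (Nat.card H + 3) := by
  obtain ⟨e⟩ : Nonempty (Fin (Nat.card H) ≃ H) := ⟨(Finite.equivFin H).symm⟩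
  -- Two leading 1s make the self-glued tetrahedra; the third only fills up the length `N + 3`.
  let s : Fin (Nat.card H + 3) → H := Fin.cons 1 (Fin.cons 1 (Fin.cons 1 e))
  have hs : Function.Surjective s := by
    intro h
    exact ⟨(e.symm h).succ.succ.succ, by simp [s]⟩
  let T := cayley H s hs
  let _ : MulAction H T.Tet :=
    { smul := fun g p => (g * p.1, p.2)
      one_smul := fun p => Prod.ext (one_mul _) rfl
      mul_smul := fun a b p => Prod.ext (mul_assoc a b _) rfl }
  have hadj : ∀ (g : H) (Δ : T.Tet) i, T.adj (g • Δ) i = g • T.adj Δ i := by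
    rintro g ⟨h, j⟩ i
    fin_cases i
    · rfl
    · rfl
    · exact Prod.ext (mul_assoc _ _ _) rfl
    · exact Prod.ext (mul_assoc _ _ _) rfl
  have hpair : ∀ (g : H) (Δ : T.Tet) i, T.pair (g • Δ) i = T.pair Δ i := fun _ _ _ => rfl
  refine ⟨T, ⟨(MulEquiv.ofBijective _ (labelHom_bijective hadj hpair
    ((1, 0) : H × Fin (Nat.card H + 3)) ?_ ?_)).symm⟩, ?_⟩
  · intro g hg
    exact (mul_one g).symm.trans (congrArg Prod.fst hg)
  · intro f
    obtain ⟨g, hg⟩ := cayley_rigid H s hs rfl rfl f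
    refine ⟨g, ?_⟩
    have : g • (show T.Tet from ((1, 0) : H × Fin (Nat.card H + 3))) =
        ((g, 0) : H × Fin (Nat.card H + 3)) := Prod.ext (mul_one g) rfl
    rw [this]
    exact hg
  · have : Finite T.Tet := T.finite_tet
    have hcard : Nat.card T.Tet = Nat.card H * (Nat.card H + 3) := by
      change Nat.card (H × Fin (Nat.card H + 3)) = _
      rw [Nat.card_prod, Nat.card_fin]
    rw [← hcard, vertices, ← Set.image_univ, ← Set.ncard_univ]
    exact Set.ncard_image_le Set.finite_univ

end Triangulation

theorem mainTheorem12 :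
    ∃ k : ℝ, 0 < k ∧
      ∀ (G : Type*) [Group G] [Finite G],
        ∃ T : Triangulation,
          Nonempty (T.combAut ≃* G) ∧
            (T.vertices.ncard : ℝ) ≤ k * (Nat.card G : ℝ) ^ 9 := by
  -- `n * (n + 3) ≤ 4 * n ^ 2` for `n ≥ 1`.
  refine ⟨4, by norm_num, fun G _ _ => ?_⟩
  -- `Tet` lives in `Type`, so `G` is replaced by a copy there.
  obtain ⟨T, ⟨e⟩, hT⟩ := Triangulation.exists_combAut_equiv (Shrink.{0} G)
  refine ⟨T, ⟨e.trans Shrink.mulEquiv⟩, ?_⟩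
  rw [Nat.card_congr (equivShrink.{0} G).symm] at hT
  have hpos : 1 ≤ Nat.card G := Nat.card_pos
  have hpow : Nat.card G ^ 2 ≤ Nat.card G ^ 9 := Nat.pow_le_pow_right hpos (by norm_num)
  have : T.vertices.ncard ≤ 4 * Nat.card G ^ 9 := by nlinarith
  exact_mod_cast this
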